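/- Let $\mathcal A=\{1,\dots,d\}$ be the set of base arms, let $\mathcal M\subseteq 2^{\mathcal A}$ be a non-empty class of super arms with $|M|\le m$ for all $M\in\mathcal M$, and let $\nu$ be a probability distribution on $[0,1]^d$ with mean vector $\boldsymbol\mu$. The reward vectors $w_1,w_2,\dots$ are drawn i.i.d. from $\nu$. Put $f(M,x)=\sum_{e\in M}x(e)$ and let $M^*\in\arg\max_{M\in\mathcal M}f(M,\boldsymbol\mu)$. In each round $t=1,\dots,n$ a super arm $M(t)\in\mathcal M$ is chosen, $w_t(e)$ is observed for $e\in M(t)$, and $f(M(t),w_t)$ is earned; the regret is $$\mathcal R_\nu(n,\pi)=\sum_{t=1}^n\bigl(\mathbb E[f(M^*,w_t)]-\mathbb E[f(M(t),w_t)]\bigr).$$ Let $u\mapsto\arg\max_{M\in\mathcal M}f(M,u)$ be an exact optimization oracle, with ties broken in a fixed (measurable) way depending on $u$ only. The algorithm MixCombUCB with parameter $\alpha$ runs as follows. *Initialization.* Start with $u(e)=1$ for all $e\in\mathcal A$ and $E=\emptyset$. While $u(e)=1$ for some $e$ that belongs to a super arm, play $M(t)=\arg\max_{M\in\mathcal M}f(M,u)$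 in the current round $t$ (starting with $t=1$) and, for every $e\in M(t)$, set $\hat w(e)=w_t(e)$, $u(e)=0$, $M_e=M(t)$ and put $e$ into $E$ (earlier values are overwritten). Let $t_0$ be one plus the number of initialization rounds, let $m_0=|E|$, and set $T_{t_0-1}(e)=1$ for all $e$. *Main loop.* In round $t=t_0,\dots,n$ let $$U_t(e)=\hat w_{T_{t-1}(e)}(e)+\sqrt{\frac{2\log(t-1)}{T_{t-1}(e)}},\qquad \tilde M(t)=\arg\max_{M\in\mathcal M}f(M,U_t),\qquad \alpha_t=\frac1{2m_0t^{\alpha}},$$ and draw $M(t)$, conditionally on the history $M(1),w_1,\dots,M(t-1),w_{t-1}$, from $$\pi_t(M)=(1-m_0\alpha_t)\,\mathbb I\{M=\tilde M(t)\}+\sum_{e\in E}\alpha_t\,\mathbb I\{M=M_e\},\qquad M\in\mathcal M,$$ where $w_t\sim\nu$ is independent of the history and of $M(t)$. For $e\in M(t)$ set $T_t(e)=T_{t-1}(e)+1$ and $\hat w_{T_t(e)}(e)=\frac{T_{t-1}(e)\,\hat w_{T_{t-1}(e)}(e)+w_t(e)}{T_t(e)}$; for $e\notin M(t)$ nothing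 changes. Then for every such class $\mathcal M$, every such $\nu$, every $\alpha\in[0,1)$ and every horizon $n$, $$\mathcal R_\nu(n,\pi)\le 54\sqrt{m\,d\,n\log n}+5md+\frac{m\,n^{1-\alpha}}{2(1-\alpha)}.$$ -/

import Mathlib

open MeasureTheory ProbabilityTheory

noncomputable section

namespace MixCombUCB

variable {d : ℕ}

/-- The total weight `f(S, x) = ∑_{e ∈ S} x(e)` of a set `S` of base arms under a vector `x`. -/
def f (S : Finset (Fin d)) (x : Fin d → ℝ) : ℝ := ∑ e ∈ S, x e

/-- An exact offline optimization oracle for the class `𝒮` of super arms: a (measurable) selection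
`u ↦ argmax_{S ∈ 𝒮} f(S, u)`. Ties may be broken in any way that is a function of `u`. -/
structure IsOracle (𝒮 : Finset (Finset (Fin d))) (oracle : (Fin d → ℝ) → Finset (Fin d)) :
    Prop where
  measurable : Measurable oracle
  mem : ∀ u, oracle u ∈ 𝒮
  le : ∀ u, ∀ S ∈ 𝒮, f S u ≤ f (oracle u) u

/-! ### The initialization `InitUCB`

Round `k + 1` of the initialization plays `oracle (initWeight oracle k)`. -/

/-- The auxiliary binary weight vector `u` after `k` initialization rounds: all ones at the start,
and the entries of the items observed in a round are set to zero. -/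
def initWeight (oracle : (Fin d → ℝ) → Finset (Fin d)) : ℕ → Fin d → ℝ
  | 0 => fun _ => 1
  | k + 1 => fun e =>
      if e ∈ oracle (initWeight oracle k) then 0 else initWeight oracle k e

/-- The set `E` of the items observed in the first `k` initialization rounds. -/
def initObserved (oracle : (Fin d → ℝ) → Finset (Fin d)) : ℕ → Finset (Fin d)
  | 0 => ∅
  | k + 1 => initObserved oracle k ∪ oracle (initWeight oracle k)

/-- The super arms `M_e` recorded in the first `k` initialization rounds; an item that is observed
again has its record overwritten. -/
def initArm (oracle : (Fin d → ℝ) → Finset (Fin d)) : ℕ → Fin d → Finset (Fin d)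
  | 0 => fun _ => ∅
  | k + 1 => fun e =>
      if e ∈ oracle (initWeight oracle k) then oracle (initWeight oracle k)
      else initArm oracle k e

/-- The observations `ŵ(e)` recorded in the first `k` initialization rounds, when the reward vector
of round `t` is `x t`; an item that is observed again has its record overwritten. -/
def initObs (oracle : (Fin d → ℝ) → Finset (Fin d)) (x : ℕ → Fin d → ℝ) : ℕ → Fin d → ℝ
  | 0 => fun _ => 0
  | k + 1 => fun e =>
      if e ∈ oracle (initWeight oracle k) then x (k + 1) e else initObs oracle x k e

/-- The number of initialization rounds: the initialization stops as soon as `u(e) = 0` for every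
item `e` that belongs to some super arm. (If the super arms cover all the items, this says that all
the entries of `u` are zero; items in no super arm can never be observed.) -/
def initSteps (𝒮 : Finset (Finset (Fin d))) (oracle : (Fin d → ℝ) → Finset (Fin d)) : ℕ :=
  sInf {k | ∀ S ∈ 𝒮, ∀ e ∈ S, initWeight oracle k e = 0}

theorem initWeight_eq (oracle : (Fin d → ℝ) → Finset (Fin d)) (k : ℕ) (e : Fin d) :
    initWeight oracle k e = 0 ∨ initWeight oracle k e = 1 := by
  induction k with
  | zero => right; rfl
  | succ k ih =>
    simp only [initWeight]
    split_ifs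
    · left; rfl
    · exact ih

/-- The initialization terminates, so `initSteps` is the minimum of a non-empty set. -/
theorem exists_initSteps {𝒮 : Finset (Finset (Fin d))} {oracle : (Fin d → ℝ) → Finset (Fin d)}
    (h : IsOracle 𝒮 oracle) : ∃ k, ∀ S ∈ 𝒮, ∀ e ∈ S, initWeight oracle k e = 0 := by
  classical
  by_contra! hne
  have key : ∀ k, k + (Finset.univ.filter fun e => initWeight oracle k e = 1).card ≤ d := by
    intro k
    induction k with
    | zero => simpa using Finset.card_le_univ (Finset.univ.filter fun e : Fin d =>
        initWeight oracle 0 e = 1)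
    | succ k ih =>
      obtain ⟨S, hS, e, he, hu⟩ := hne k
      have hu1 : initWeight oracle k e = 1 := (initWeight_eq oracle k e).resolve_left hu
      have hnn : ∀ e, 0 ≤ initWeight oracle k e := fun e => by
        rcases initWeight_eq oracle k e with h0 | h0 <;> simp [h0]
      have h1 : 1 ≤ f S (initWeight oracle k) := by
        rw [← hu1]
        exact Finset.single_le_sum (fun i _ => hnn i) he
      have h2 := h1.trans (h.le (initWeight oracle k) S hS)
      obtain ⟨a, ha, ha0⟩ : ∃ a ∈ oracle (initWeight oracle k), initWeight oracle k a ≠ 0 := by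
        by_contra! hz
        rw [f, Finset.sum_eq_zero hz] at h2
        linarith
      have ha1 := (initWeight_eq oracle k a).resolve_left ha0
      have hlt : (Finset.univ.filter fun e => initWeight oracle (k + 1) e = 1).card
          < (Finset.univ.filter fun e => initWeight oracle k e = 1).card := by
        apply Finset.card_lt_card
        rw [Finset.ssubset_iff_of_subset]
        · refine ⟨a, Finset.mem_filter.2 ⟨Finset.mem_univ _, ha1⟩, fun hmem => ?_⟩
          have h3 := (Finset.mem_filter.1 hmem).2
          simp [initWeight, ha] at h3
        · intro b hb
          have h3 := (Finset.mem_filter.1 hb).2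
          refine Finset.mem_filter.2 ⟨Finset.mem_univ _, ?_⟩
          by_cases hbo : b ∈ oracle (initWeight oracle k)
          · simp [initWeight, hbo] at h3
          · simpa [initWeight, hbo] using h3
      omega
  have := key (d + 1)
  omega

/-! ### The main loop

Below, `x t` is the reward vector of round `t` and `A t` the super arm played in round `t`, along
one trajectory; `t₀` is the first round of the main loop. -/

/-- The counter `T_t(e)`. It equals `1` until the initialization is over, and then counts every
observation of `e` in the main loop. -/
def count (t₀ : ℕ) (A : ℕ → Finset (Fin d)) : ℕ → Fin d → ℕ
  | 0 => fun _ => 1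
  | t + 1 => fun e =>
      if t₀ ≤ t + 1 ∧ e ∈ A (t + 1) then count t₀ A t e + 1 else count t₀ A t e

/-- The empirical mean `ŵ_{T_t(e)}(e)` at the end of round `t ≥ t₀ - 1`: it starts from the value
`w₀ e` recorded by the initialization and is updated at every observation of `e` in the main
loop. -/
def mean (t₀ : ℕ) (w₀ : Fin d → ℝ) (x : ℕ → Fin d → ℝ) (A : ℕ → Finset (Fin d)) :
    ℕ → Fin d → ℝ
  | 0 => w₀
  | t + 1 => fun e =>
      if t₀ ≤ t + 1 ∧ e ∈ A (t + 1) then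
        ((count t₀ A t e : ℝ) * mean t₀ w₀ x A t e + x (t + 1) e) / (count t₀ A (t + 1) e : ℝ)
      else mean t₀ w₀ x A t e

/-- The confidence radius `c_{t,s} = √(2 log t / s)`. -/
def radius (t s : ℕ) : ℝ := Real.sqrt (2 * Real.log t / s)

/-- The upper confidence bounds `U_t(e) = ŵ_{T_{t-1}(e)}(e) + c_{t-1, T_{t-1}(e)}`. -/
def ucb (t₀ : ℕ) (w₀ : Fin d → ℝ) (x : ℕ → Fin d → ℝ) (A : ℕ → Finset (Fin d)) (t : ℕ)
    (e : Fin d) : ℝ :=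
  mean t₀ w₀ x A (t - 1) e + radius (t - 1) (count t₀ A (t - 1) e)

/-- The exploration weight `α_t = 1 / (2 m₀ t^α)`. -/
def exploreWeight (α : ℝ) (m₀ t : ℕ) : ℝ := 1 / (2 * m₀ * (t : ℝ) ^ α)

open Classical in
/-- The distribution over super arms from which the algorithm draws in a round `t` of the main loop,
given the past trajectory:
`π_t(S) = (1 - m₀ α_t) 𝟙{S = M̃(t)} + ∑_{e ∈ E} α_t 𝟙{S = M_e}`, where `m₀ = |E|` and
`M̃(t) = argmax_{S ∈ 𝒮} f(S, U_t)`. -/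
def policy (𝒮 : Finset (Finset (Fin d))) (oracle : (Fin d → ℝ) → Finset (Fin d)) (α : ℝ)
    (x : ℕ → Fin d → ℝ) (A : ℕ → Finset (Fin d)) (t : ℕ) (S : Finset (Fin d)) : ℝ :=
  let s := initSteps 𝒮 oracle
  let E := initObserved oracle s
  let a := exploreWeight α E.card t
  (1 - E.card * a) * (if S = oracle (ucb (s + 1) (initObs oracle x s) x A t) then 1 else 0) +
    ∑ e ∈ E, a * (if S = initArm oracle s e then 1 else 0)

/-- The history `ℋ_{t-1}`: the σ-algebra generated by `M(1), w_1, …, M(t-1), w_{t-1}`. -/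
abbrev history {Ω : Type*} (M : ℕ → Ω → Finset (Fin d)) (w : ℕ → Ω → Fin d → ℝ) (t : ℕ) :
    MeasurableSpace Ω :=
  ⨆ s ∈ Finset.Icc 1 (t - 1),
    (MeasurableSpace.comap (M s) inferInstance ⊔ MeasurableSpace.comap (w s) inferInstance)

/-- `M t` and `w t`, for `1 ≤ t ≤ n`, are the super arms played and the reward vectors drawn when
`MixCombUCB` with parameter `α` interacts for `n` rounds with the bandit instance of reward
distribution `ν` and class of super arms `𝒮`. -/
structure IsRun {Ω : Type*} [MeasurableSpace Ω] (P : Measure Ω) (ν : Measure (Fin d → ℝ))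
    (𝒮 : Finset (Finset (Fin d))) (oracle : (Fin d → ℝ) → Finset (Fin d)) (α : ℝ) (n : ℕ)
    (M : ℕ → Ω → Finset (Fin d)) (w : ℕ → Ω → Fin d → ℝ) : Prop where
  measurable_arm : ∀ t ∈ Finset.Icc 1 n, Measurable (M t)
  measurable_reward : ∀ t ∈ Finset.Icc 1 n, Measurable (w t)
  /-- Every reward vector is drawn from `ν`, ... -/
  law_reward : ∀ t ∈ Finset.Icc 1 n, P.map (w t) = ν
  /-- ... independently of the history and of the super arm chosen in the same round. -/
  indep_reward : ∀ t ∈ Finset.Icc 1 n,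
    Indep (MeasurableSpace.comap (w t) inferInstance)
      (history M w t ⊔ MeasurableSpace.comap (M t) inferInstance) P
  /-- Initialization rounds. -/
  init : ∀ t ∈ Finset.Icc 1 n, t ≤ initSteps 𝒮 oracle →
    ∀ᵐ ω ∂P, M t ω = oracle (initWeight oracle (t - 1))
  /-- Rounds of the main loop: given the history, `M t` is drawn from `π_t`. -/
  main : ∀ t ∈ Finset.Icc 1 n, initSteps 𝒮 oracle < t → ∀ S ∈ 𝒮,
    P⟦M t ⁻¹' {S} | history M w t⟧ =ᵐ[P]
      fun ω => policy 𝒮 oracle α (fun i => w i ω) (fun i => M i ω) t S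

/-- The cumulative regret `∑_{t=1}^n (𝔼[f(M*, w_t)] - 𝔼[f(M(t), w_t)])` with respect to the super
arm `Mstar`. -/
def regret {Ω : Type*} [MeasurableSpace Ω] (P : Measure Ω) (n : ℕ)
    (Mstar : Finset (Fin d)) (M : ℕ → Ω → Finset (Fin d)) (w : ℕ → Ω → Fin d → ℝ) : ℝ :=
  ∑ t ∈ Finset.Icc 1 n, ((∫ ω, f Mstar (w t ω) ∂P) - ∫ ω, f (M t ω) (w t ω) ∂P)

end MixCombUCB

end

/-!
The regret of a round is, in expectation, the gap `f(M*, μ) - f(M(t), μ)` of the super arm that is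
played (`IsRun.integral_reward_eq`), because the rewards of the round are independent of the choice
of the super arm. The initialization has at most `d` rounds (`initSteps_le`), each of which costs at
most `m`.

In a round of the main loop, averaging over the sampling distribution (`IsRun.integral_arm_eq`)
splits the gap into the exploration, which has total probability `m₀ α_t ≤ 1 / (2 t^α)` and costs
at most `m`, and the gap of the optimistic super arm `M̃(t)`, with weight `1 - m₀ α_t`. If all
confidence intervals hold, the gap of `M̃(t)` is at most twice the width `∑_{e ∈ M̃(t)} c_{t-1,T(e)}`
(`gap_greedyArm_le`). The sampling distribution gives `M̃(t)` at least the mass `1 - m₀ α_t`, so the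
weighted expected width of `M̃(t)` is at most the expected width of the super arm that is actually
played (`IsRun.integral_gap_le`); no inverse of `1 - m₀ α_t` appears. Playing `M(t)` increases the
counters of its items, so along each trajectory these widths add up to
`O(√(log n)) ∑_e √(T_n(e) - 1) = O(√(m d n log n))` by the Cauchy-Schwarz inequality
(`sum_radius_le`).

The confidence intervals of round `t` fail with probability at most `2 d / (t - 1)²`
(`IsRun.measureReal_bad_le`). The counters are random, so Hoeffding's inequality for a fixed sample
size does not apply; instead `exp (l T_t(e) (ŵ_t(e) - μ(e)) - l² T_t(e) / 8)` is a supermartingale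
(`IsRun.lintegral_exp_le_one`), and a union bound over the at most `t - 1` possible values of the
counter, with `l` adapted to the value, gives the claim. The failures contribute at most `4 m d`.
-/

noncomputable section

namespace MixCombUCB

/-! ### The initialization -/

section Init

variable {d : ℕ} {𝒮 : Finset (Finset (Fin d))} {oracle : (Fin d → ℝ) → Finset (Fin d)}

theorem initWeight_eq_zero_of_mem_initSteps (h : IsOracle 𝒮 oracle) {S : Finset (Fin d)}
    (hS : S ∈ 𝒮) {e : Fin d} (he : e ∈ S) : initWeight oracle (initSteps 𝒮 oracle) e = 0 :=
  Nat.sInf_mem (s := {k | ∀ S ∈ 𝒮, ∀ e ∈ S, initWeight oracle k e = 0}) (exists_initSteps h)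
    S hS e he

/-- As long as the initialization goes on, every round zeroes at least one more entry of the
auxiliary weight vector. -/
theorem card_initWeight_add_le (h : IsOracle 𝒮 oracle) (k : ℕ) (hk : k ≤ initSteps 𝒮 oracle) :
    k + (Finset.univ.filter fun e => initWeight oracle k e = 1).card ≤ d := by
  classical
  induction k with
  | zero => simpa using Finset.card_le_univ (Finset.univ.filter fun e : Fin d =>
      initWeight oracle 0 e = 1)
  | succ k ih =>
    have ih := ih (Nat.le_of_succ_le hk)
    have hne : k ∉ {k | ∀ S ∈ 𝒮, ∀ e ∈ S, initWeight oracle k e = 0} :=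
      Nat.notMem_of_lt_sInf hk
    simp only [Set.mem_ofPred_eq, not_forall] at hne
    obtain ⟨S, hS, e, he, hu⟩ := hne
    have hu1 := (initWeight_eq oracle k e).resolve_left hu
    have hnn : ∀ e, 0 ≤ initWeight oracle k e := fun e => by
      rcases initWeight_eq oracle k e with h0 | h0 <;> simp [h0]
    have h1 : 1 ≤ f S (initWeight oracle k) := by
      rw [← hu1]
      exact Finset.single_le_sum (fun i _ => hnn i) he
    have h2 := h1.trans (h.le (initWeight oracle k) S hS)
    obtain ⟨a, ha, ha0⟩ : ∃ a ∈ oracle (initWeight oracle k), initWeight oracle k a ≠ 0 := by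
      by_contra! hz
      rw [f, Finset.sum_eq_zero hz] at h2
      linarith
    have hlt : (Finset.univ.filter fun e => initWeight oracle (k + 1) e = 1).card
        < (Finset.univ.filter fun e => initWeight oracle k e = 1).card := by
      apply Finset.card_lt_card
      rw [Finset.ssubset_iff_of_subset]
      · refine ⟨a, Finset.mem_filter.2
          ⟨Finset.mem_univ _, (initWeight_eq oracle k a).resolve_left ha0⟩, fun hmem => ?_⟩
        have h3 := (Finset.mem_filter.1 hmem).2
        simp [initWeight, ha] at h3
      · intro b hb
        have h3 := (Finset.mem_filter.1 hb).2
        refine Finset.mem_filter.2 ⟨Finset.mem_univ _, ?_⟩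
        by_cases hbo : b ∈ oracle (initWeight oracle k)
        · simp [initWeight, hbo] at h3
        · simpa [initWeight, hbo] using h3
    omega

theorem initSteps_le (h : IsOracle 𝒮 oracle) : initSteps 𝒮 oracle ≤ d :=
  (Nat.le_add_right _ _).trans (card_initWeight_add_le h _ le_rfl)

theorem initSteps_pos (h : IsOracle 𝒮 oracle) {S : Finset (Fin d)} (hS : S ∈ 𝒮) {e : Fin d}
    (he : e ∈ S) : 0 < initSteps 𝒮 oracle := by
  rw [Nat.pos_iff_ne_zero]
  intro h0
  have := initWeight_eq_zero_of_mem_initSteps h hS he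
  simp [h0, initWeight] at this

theorem mem_initObserved_of_initWeight_eq_zero {k : ℕ} {e : Fin d}
    (h : initWeight oracle k e = 0) : e ∈ initObserved oracle k := by
  induction k with
  | zero => simp [initWeight] at h
  | succ k ih =>
    by_cases he : e ∈ oracle (initWeight oracle k)
    · simp [initObserved, he]
    · simp [initObserved, ih (by simpa [initWeight, he] using h)]

theorem initArm_mem (h : IsOracle 𝒮 oracle) {k : ℕ} {e : Fin d}
    (he : e ∈ initObserved oracle k) : initArm oracle k e ∈ 𝒮 := by
  induction k with
  | zero => simp [initObserved] at he
  | succ k ih =>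
    by_cases hk : e ∈ oracle (initWeight oracle k)
    · simpa [initArm, hk] using h.mem _
    · simpa [initArm, hk] using ih (by simpa [initObserved, hk] using he)

/-- The observation kept by the initialization comes from a round that does not depend on the
rewards: the initialization is deterministic. -/
theorem exists_initObs_eq {k : ℕ} {e : Fin d} (he : e ∈ initObserved oracle k) :
    ∃ τ, 1 ≤ τ ∧ τ ≤ k ∧ ∀ x : ℕ → Fin d → ℝ, initObs oracle x k e = x τ e := by
  induction k with
  | zero => simp [initObserved] at he
  | succ k ih =>
    by_cases hk : e ∈ oracle (initWeight oracle k)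
    · exact ⟨k + 1, by omega, le_rfl, fun x => by simp [initObs, hk]⟩
    · obtain ⟨τ, h1, h2, h3⟩ := ih (by simpa [initObserved, hk] using he)
      exact ⟨τ, h1, by omega, fun x => by simp [initObs, hk, h3]⟩

end Init

/-! ### Counters and empirical means along a trajectory -/

section Trajectory

variable {d : ℕ} {s : ℕ} {A : ℕ → Finset (Fin d)}

theorem one_le_count (t₀ : ℕ) (A : ℕ → Finset (Fin d)) (t : ℕ) (e : Fin d) :
    1 ≤ count t₀ A t e := by
  induction t with
  | zero => exact le_rfl
  | succ t ih => simp only [count]; split_ifs <;> omega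

theorem count_eq_one_of_lt {t₀ t : ℕ} (ht : t < t₀) (e : Fin d) : count t₀ A t e = 1 := by
  induction t with
  | zero => rfl
  | succ t ih => simp [count, show ¬ t₀ ≤ t + 1 by omega, ih (by omega)]

theorem mean_eq_of_lt {t₀ t : ℕ} {w₀ : Fin d → ℝ} {x : ℕ → Fin d → ℝ} (ht : t < t₀) :
    mean t₀ w₀ x A t = w₀ := by
  induction t with
  | zero => rfl
  | succ t ih => simp [mean, show ¬ t₀ ≤ t + 1 by omega, ih (by omega)]

theorem count_succ {t : ℕ} (hst : s ≤ t) (e : Fin d) :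
    count (s + 1) A (t + 1) e = count (s + 1) A t e + if e ∈ A (t + 1) then 1 else 0 := by
  by_cases he : e ∈ A (t + 1) <;> simp [count, he, hst]

theorem count_add_le {t : ℕ} (hst : s ≤ t) (e : Fin d) :
    count (s + 1) A t e + s ≤ t + 1 := by
  induction t, hst using Nat.le_induction with
  | base => rw [count_eq_one_of_lt (by omega)]; omega
  | succ t hst ih => rw [count_succ hst]; split_ifs <;> omega

theorem count_mul_mean_sub_succ {w₀ : Fin d → ℝ} {x : ℕ → Fin d → ℝ} {t : ℕ} (hst : s ≤ t)
    (e : Fin d) (c : ℝ) :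
    (count (s + 1) A (t + 1) e : ℝ) * (mean (s + 1) w₀ x A (t + 1) e - c)
      = count (s + 1) A t e * (mean (s + 1) w₀ x A t e - c)
        + if e ∈ A (t + 1) then x (t + 1) e - c else 0 := by
  by_cases he : e ∈ A (t + 1)
  · have h0 : (count (s + 1) A (t + 1) e : ℝ) ≠ 0 := by
      have := one_le_count (s + 1) A (t + 1) e
      positivity
    have h1 : (count (s + 1) A (t + 1) e : ℝ) = count (s + 1) A t e + 1 := by
      rw [count_succ hst]; simp [he]
    have h2 : (count (s + 1) A (t + 1) e : ℝ) * mean (s + 1) w₀ x A (t + 1) e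
        = count (s + 1) A t e * mean (s + 1) w₀ x A t e + x (t + 1) e := by
      simp only [mean, he, and_true, add_le_add_iff_right, hst, if_true]
      field_simp
    rw [mul_sub, h2, h1]
    simp only [he, if_true]
    ring
  · simp [count, mean, he]

/-- The comparison that lets the confidence radii telescope along a trajectory. -/
theorem inv_sqrt_le_two_mul_sqrt_sub {c : ℝ} (hc : 1 ≤ c) :
    1 / √c ≤ 2 * √c - 2 * √(c - 1) := by
  have h0 : 0 < √c := Real.sqrt_pos.2 (by linarith)
  have h1 := Real.sq_sqrt (show 0 ≤ c by linarith)
  have h2 := Real.sq_sqrt (show 0 ≤ c - 1 by linarith)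
  rw [div_le_iff₀ h0]
  nlinarith [sq_nonneg (√c - √(c - 1))]

theorem sum_inv_sqrt_count_le {n : ℕ} (hsn : s ≤ n) :
    ∑ t ∈ Finset.Ioc s n, ∑ e ∈ A t, 1 / √(count (s + 1) A (t - 1) e : ℝ)
      ≤ ∑ e, 2 * √((count (s + 1) A n e : ℝ) - 1) := by
  induction n, hsn using Nat.le_induction with
  | base =>
    simp only [Finset.Ioc_self, Finset.sum_empty]
    exact Finset.sum_nonneg fun e _ => by positivity
  | succ t hst ih =>
    have h0 : ∑ e ∈ A (t + 1), 1 / √(count (s + 1) A t e : ℝ)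
        = ∑ e, if e ∈ A (t + 1) then 1 / √(count (s + 1) A t e : ℝ) else 0 := by simp
    rw [Finset.sum_Ioc_succ_top hst, Nat.add_sub_cancel, h0]
    refine (add_le_add_left ih _).trans ?_
    rw [← Finset.sum_add_distrib]
    refine Finset.sum_le_sum fun e _ => ?_
    rw [count_succ hst]
    split_ifs with he
    · have h1 : (1 : ℝ) ≤ count (s + 1) A t e := by exact_mod_cast one_le_count _ _ _ _
      have h2 := inv_sqrt_le_two_mul_sqrt_sub h1
      push_cast
      rw [add_sub_cancel_right]
      linarith
    · simp

theorem sum_count_sub_one_le {n m : ℕ} (hsn : s ≤ n)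
    (hA : ∀ t ∈ Finset.Ioc s n, (A t).card ≤ m) :
    ∑ e, ((count (s + 1) A n e : ℝ) - 1) ≤ m * n := by
  induction n, hsn using Nat.le_induction with
  | base => simp [count_eq_one_of_lt]; positivity
  | succ t hst ih =>
    have ih := ih fun i hi => hA i (Finset.Ioc_subset_Ioc_right (by omega) hi)
    have h2 : ((A (t + 1)).card : ℝ) ≤ m := by
      exact_mod_cast hA (t + 1) (by simp; omega)
    have h3 : ∀ e, ((count (s + 1) A (t + 1) e : ℝ) - 1)
        = ((count (s + 1) A t e : ℝ) - 1) + if e ∈ A (t + 1) then 1 else 0 := fun e => by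
      rw [count_succ hst]; push_cast; ring
    simp only [h3, Finset.sum_add_distrib]
    simp only [Finset.sum_ite_mem, Finset.univ_inter, Finset.sum_const, nsmul_eq_mul, mul_one]
    push_cast
    linarith

/-- Along a trajectory, the confidence radii (up to the logarithmic factor) of the items that are
played add up to at most `2 √(d m n)`. -/
theorem sum_inv_sqrt_count_le_sqrt {n m : ℕ} (hsn : s ≤ n)
    (hA : ∀ t ∈ Finset.Ioc s n, (A t).card ≤ m) :
    ∑ t ∈ Finset.Ioc s n, ∑ e ∈ A t, 1 / √(count (s + 1) A (t - 1) e : ℝ)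
      ≤ 2 * √(m * d * n) := by
  refine (sum_inv_sqrt_count_le hsn).trans ?_
  rw [← Finset.mul_sum]
  gcongr
  apply Real.le_sqrt_of_sq_le
  refine sq_sum_le_card_mul_sum_sq.trans ?_
  have h1 : ∀ e, √((count (s + 1) A n e : ℝ) - 1) ^ 2 = (count (s + 1) A n e : ℝ) - 1 := fun e =>
    Real.sq_sqrt (by
      have : (1 : ℝ) ≤ count (s + 1) A n e := by exact_mod_cast one_le_count _ _ _ _
      linarith)
  simp only [h1, Finset.card_univ, Fintype.card_fin]
  nlinarith [mul_le_mul_of_nonneg_left (sum_count_sub_one_le hsn hA) (Nat.cast_nonneg (α := ℝ) d)]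

theorem radius_nonneg (t k : ℕ) : 0 ≤ radius t k := Real.sqrt_nonneg _

theorem radius_le {t n : ℕ} (htn : t ≤ n) (k : ℕ) :
    radius t k ≤ √(2 * Real.log n) * (1 / √(k : ℝ)) := by
  rcases Nat.eq_zero_or_pos t with rfl | ht
  · simp only [radius, Nat.cast_zero, Real.log_zero, mul_zero, zero_div, Real.sqrt_zero]
    positivity
  rw [mul_one_div, ← Real.sqrt_div (by positivity)]
  unfold radius
  gcongr

theorem sum_radius_le {n m : ℕ} (hsn : s ≤ n)
    (hA : ∀ t ∈ Finset.Ioc s n, (A t).card ≤ m) :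
    ∑ t ∈ Finset.Ioc s n, ∑ e ∈ A t, radius (t - 1) (count (s + 1) A (t - 1) e)
      ≤ 2 * √2 * √(m * d * n * Real.log n) := by
  calc _ ≤ ∑ t ∈ Finset.Ioc s n, ∑ e ∈ A t,
        √(2 * Real.log n) * (1 / √(count (s + 1) A (t - 1) e : ℝ)) := by
        refine Finset.sum_le_sum fun t ht => Finset.sum_le_sum fun e _ => ?_
        have := Finset.mem_Ioc.1 ht
        exact radius_le (by omega) _
    _ = √(2 * Real.log n) *
        ∑ t ∈ Finset.Ioc s n, ∑ e ∈ A t, 1 / √(count (s + 1) A (t - 1) e : ℝ) := by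
        simp only [Finset.mul_sum]
    _ ≤ √(2 * Real.log n) * (2 * √(m * d * n)) := by
        gcongr
        exact sum_inv_sqrt_count_le_sqrt hsn hA
    _ = _ := by
        rw [Real.sqrt_mul (by positivity), Real.sqrt_mul (x := m * d * n) (by positivity)]
        ring

end Trajectory

/-! ### Two numerical series -/

theorem one_sub_mul_rpow_neg_le {α : ℝ} (hα₀ : 0 ≤ α) (hα₁ : α < 1) (k : ℕ) :
    (1 - α) * ((k + 1 : ℕ) : ℝ) ^ (-α) ≤ ((k + 1 : ℕ) : ℝ) ^ (1 - α) - (k : ℝ) ^ (1 - α) := by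
  have hk : (0 : ℝ) < ((k + 1 : ℕ) : ℝ) := by positivity
  have h1 : (-1 : ℝ) ≤ -1 / ((k + 1 : ℕ) : ℝ) := by
    rw [le_div_iff₀ hk]; push_cast; linarith [Nat.cast_nonneg (α := ℝ) k]
  have h := rpow_one_add_le_one_add_mul_self h1 (p := 1 - α) (by linarith) (by linarith)
  have h2 : (1 : ℝ) + -1 / ((k + 1 : ℕ) : ℝ) = k / ((k + 1 : ℕ) : ℝ) := by
    field_simp; push_cast; ring
  rw [h2, Real.div_rpow (by positivity) hk.le, div_le_iff₀ (by positivity)] at h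
  have h3 : ((k + 1 : ℕ) : ℝ) ^ (1 - α) = ((k + 1 : ℕ) : ℝ) ^ (-α) * ((k + 1 : ℕ) : ℝ) := by
    rw [← Real.rpow_add_one hk.ne']; ring_nf
  have h4 : (1 + (1 - α) * (-1 / ((k + 1 : ℕ) : ℝ))) * ((k + 1 : ℕ) : ℝ) ^ (1 - α)
      = ((k + 1 : ℕ) : ℝ) ^ (1 - α) - (1 - α) * ((k + 1 : ℕ) : ℝ) ^ (-α) := by
    rw [h3]; field_simp; ring
  linarith

theorem sum_rpow_neg_le {α : ℝ} (hα₀ : 0 ≤ α) (hα₁ : α < 1) (n : ℕ) :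
    ∑ t ∈ Finset.Icc 1 n, (t : ℝ) ^ (-α) ≤ (n : ℝ) ^ (1 - α) / (1 - α) := by
  rw [le_div_iff₀ (by linarith), mul_comm]
  induction n with
  | zero => simp; positivity
  | succ k ih =>
    rw [Finset.sum_Icc_succ_top (by omega), mul_add]
    linarith [one_sub_mul_rpow_neg_le hα₀ hα₁ k]

/-- The summand of `t = 1` is `1 / 0 = 0`. -/
theorem sum_inv_sq_le_two (n : ℕ) :
    ∑ t ∈ Finset.Icc 1 n, (1 : ℝ) / ((t - 1 : ℕ) : ℝ) ^ 2 ≤ 2 := by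
  have key : ∀ k : ℕ, ∑ t ∈ Finset.Icc 1 (k + 2), (1 : ℝ) / ((t - 1 : ℕ) : ℝ) ^ 2 ≤ 2 - 1 / ((k : ℝ) + 1) := by
    intro k
    induction k with
    | zero => simp [Finset.sum_Icc_succ_top]; norm_num
    | succ k ih =>
      rw [Finset.sum_Icc_succ_top (by omega)]
      have : (1 : ℝ) / ((k + 1 + 2 - 1 : ℕ) : ℝ) ^ 2 ≤ 1 / ((k : ℝ) + 1) - 1 / ((k : ℝ) + 1 + 1) := by
        rw [show k + 1 + 2 - 1 = k + 2 by omega, div_sub_div _ _ (by positivity) (by positivity),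
          div_le_div_iff₀ (by positivity) (by positivity)]
        push_cast
        nlinarith [Nat.cast_nonneg (α := ℝ) k]
      push_cast at this ⊢
      linarith
  refine (Finset.sum_le_sum_of_subset_of_nonneg
    (Finset.Icc_subset_Icc_right (show n ≤ n + 2 by omega)) fun _ _ _ => by positivity).trans
    ((key n).trans ?_)
  have : (0 : ℝ) ≤ 1 / (n + 1) := by positivity
  linarith

/-! ### The random trajectory and its measurability -/

section Run

variable {d : ℕ} {Ω : Type*}

/-- The counter `T_t(e)` as a random variable. -/
def runCount (𝒮 : Finset (Finset (Fin d))) (oracle : (Fin d → ℝ) → Finset (Fin d))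
    (M : ℕ → Ω → Finset (Fin d)) (t : ℕ) (e : Fin d) (ω : Ω) : ℕ :=
  count (initSteps 𝒮 oracle + 1) (fun i => M i ω) t e

/-- The empirical mean `ŵ_{T_t(e)}(e)` as a random variable. -/
def runMean (𝒮 : Finset (Finset (Fin d))) (oracle : (Fin d → ℝ) → Finset (Fin d))
    (M : ℕ → Ω → Finset (Fin d)) (w : ℕ → Ω → Fin d → ℝ) (t : ℕ) (e : Fin d) (ω : Ω) : ℝ :=
  mean (initSteps 𝒮 oracle + 1) (initObs oracle (fun i => w i ω) (initSteps 𝒮 oracle))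
    (fun i => w i ω) (fun i => M i ω) t e

/-- The optimistic super arm `M̃(t)` as a random variable. -/
def greedyArm (𝒮 : Finset (Finset (Fin d))) (oracle : (Fin d → ℝ) → Finset (Fin d))
    (M : ℕ → Ω → Finset (Fin d)) (w : ℕ → Ω → Fin d → ℝ) (t : ℕ) (ω : Ω) : Finset (Fin d) :=
  oracle (ucb (initSteps 𝒮 oracle + 1) (initObs oracle (fun i => w i ω) (initSteps 𝒮 oracle))
    (fun i => w i ω) (fun i => M i ω) t)

/-- The width `∑_{e ∈ S} c_{t-1, T_{t-1}(e)}` of the confidence interval of the super arm `S` in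
round `t`. -/
def width (𝒮 : Finset (Finset (Fin d))) (oracle : (Fin d → ℝ) → Finset (Fin d))
    (M : ℕ → Ω → Finset (Fin d)) (t : ℕ) (S : Finset (Fin d)) (ω : Ω) : ℝ :=
  ∑ e ∈ S, radius (t - 1) (runCount 𝒮 oracle M (t - 1) e ω)

variable {𝒮 : Finset (Finset (Fin d))} {oracle : (Fin d → ℝ) → Finset (Fin d)}
  {M : ℕ → Ω → Finset (Fin d)} {w : ℕ → Ω → Fin d → ℝ}

theorem measurableSet_mem {_ : MeasurableSpace Ω} {X : Ω → Finset (Fin d)} (hX : Measurable X)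
    (e : Fin d) : MeasurableSet {ω | e ∈ X ω} :=
  hX (.of_discrete (s := {S | e ∈ S}))

theorem measurable_initObs {m' : MeasurableSpace Ω} {k : ℕ}
    (hw : ∀ i ∈ Finset.Icc 1 k, Measurable (w i)) (e : Fin d) :
    Measurable fun ω => initObs oracle (fun i => w i ω) k e := by
  induction k with
  | zero => exact measurable_const
  | succ k ih =>
    by_cases he : e ∈ oracle (initWeight oracle k)
    · simpa [initObs, he] using (measurable_pi_iff.1 (hw (k + 1) (by simp))) e
    · simpa [initObs, he] using ih fun i hi => hw i (Finset.Icc_subset_Icc_right (by omega) hi)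

theorem measurable_runCount {m' : MeasurableSpace Ω} {t : ℕ}
    (hM : ∀ i ∈ Finset.Icc 1 t, Measurable (M i)) (e : Fin d) :
    Measurable (runCount 𝒮 oracle M t e) := by
  unfold runCount
  induction t with
  | zero => exact measurable_const
  | succ t ih =>
    have ih := ih fun i hi => hM i (Finset.Icc_subset_Icc_right (by omega) hi)
    by_cases ht : initSteps 𝒮 oracle + 1 ≤ t + 1
    · simp only [count, ht, true_and]
      exact Measurable.ite (measurableSet_mem (hM (t + 1) (by simp)) e) (by fun_prop) ih
    · simpa only [count, ht, false_and, if_false] using ih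

theorem measurable_runMean {m' : MeasurableSpace Ω} {t : ℕ}
    (hM : ∀ i ∈ Finset.Icc 1 t, Measurable (M i)) (hw : ∀ i ∈ Finset.Icc 1 t, Measurable (w i))
    (hst : initSteps 𝒮 oracle ≤ t) (e : Fin d) :
    Measurable (runMean 𝒮 oracle M w t e) := by
  have hw₀ : Measurable fun ω => initObs oracle (fun i => w i ω) (initSteps 𝒮 oracle) e :=
    measurable_initObs (fun i hi => hw i (Finset.Icc_subset_Icc_right hst hi)) e
  clear hst
  unfold runMean
  induction t with
  | zero => exact hw₀
  | succ t ih =>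
    have ih := ih (fun i hi => hM i (Finset.Icc_subset_Icc_right (by omega) hi))
      (fun i hi => hw i (Finset.Icc_subset_Icc_right (by omega) hi))
    have hc : Measurable (runCount 𝒮 oracle M t e) := measurable_runCount
      (fun i hi => hM i (Finset.Icc_subset_Icc_right (by omega) hi)) e
    have hc' : Measurable (runCount 𝒮 oracle M (t + 1) e) := measurable_runCount hM e
    have hx := (measurable_pi_iff.1 (hw (t + 1) (by simp))) e
    unfold runCount at hc hc'
    by_cases ht : initSteps 𝒮 oracle + 1 ≤ t + 1
    · simp only [mean, ht, true_and]
      refine Measurable.ite (measurableSet_mem (hM (t + 1) (by simp)) e) ?_ ih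
      have hcr : Measurable fun ω =>
          (count (initSteps 𝒮 oracle + 1) (fun i => M i ω) t e : ℝ) :=
        (measurable_of_countable _).comp hc
      have hcr' : Measurable fun ω =>
          (count (initSteps 𝒮 oracle + 1) (fun i => M i ω) (t + 1) e : ℝ) :=
        (measurable_of_countable _).comp hc'
      exact ((hcr.mul ih).add hx).div hcr'
    · simpa only [mean, ht, false_and, if_false] using ih

theorem measurable_width {m' : MeasurableSpace Ω} {t : ℕ}
    (hM : ∀ i ∈ Finset.Icc 1 (t - 1), Measurable (M i)) (S : Finset (Fin d)) :
    Measurable (width 𝒮 oracle M t S) := by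
  unfold width
  exact Finset.measurable_sum _ fun e _ =>
    (measurable_of_countable (radius (t - 1))).comp (measurable_runCount hM e)

theorem measurable_greedyArm (h : IsOracle 𝒮 oracle) {m' : MeasurableSpace Ω} {t : ℕ}
    (hM : ∀ i ∈ Finset.Icc 1 (t - 1), Measurable (M i))
    (hw : ∀ i ∈ Finset.Icc 1 (t - 1), Measurable (w i)) (hst : initSteps 𝒮 oracle ≤ t - 1) :
    Measurable (greedyArm 𝒮 oracle M w t) := by
  refine h.measurable.comp (measurable_pi_iff.2 fun e => ?_)
  exact (measurable_runMean hM hw hst e).add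
    ((measurable_of_countable (radius (t - 1))).comp (measurable_runCount hM e))

theorem measurable_arm_history {t i : ℕ} (hi : i ∈ Finset.Icc 1 (t - 1)) :
    Measurable[history M w t] (M i) :=
  Measurable.mono (comap_measurable (M i))
    (le_sup_left.trans (le_iSup₂_of_le i hi le_rfl)) le_rfl

theorem measurable_reward_history {t i : ℕ} (hi : i ∈ Finset.Icc 1 (t - 1)) :
    Measurable[history M w t] (w i) :=
  Measurable.mono (comap_measurable (w i))
    (le_sup_right.trans (le_iSup₂_of_le i hi le_rfl)) le_rfl

theorem one_le_runCount (t : ℕ) (e : Fin d) (ω : Ω) : 1 ≤ runCount 𝒮 oracle M t e ω :=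
  one_le_count _ _ _ _

theorem width_nonneg (t : ℕ) (S : Finset (Fin d)) (ω : Ω) : 0 ≤ width 𝒮 oracle M t S ω :=
  Finset.sum_nonneg fun _ _ => radius_nonneg _ _

theorem width_le (t : ℕ) (S : Finset (Fin d)) (ω : Ω) :
    width 𝒮 oracle M t S ω ≤ ∑ _e ∈ S, √(2 * Real.log (t - 1 : ℕ)) := by
  refine Finset.sum_le_sum fun e _ => (radius_le le_rfl _).trans ?_
  refine mul_le_of_le_one_right (Real.sqrt_nonneg _) ?_
  have h1 : (1 : ℝ) ≤ runCount 𝒮 oracle M (t - 1) e ω := by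
    exact Nat.one_le_cast.2 (one_le_runCount (t - 1) e ω)
  rw [div_le_one (by positivity)]
  exact Real.one_le_sqrt.2 h1

end Run

/-! ### Concentration of the empirical means -/

section Concentration

variable {d n : ℕ} {α : ℝ} {𝒮 : Finset (Finset (Fin d))}
  {oracle : (Fin d → ℝ) → Finset (Fin d)} {ν : Measure (Fin d → ℝ)}
  {Ω : Type*} {mΩ : MeasurableSpace Ω} {P : Measure Ω}
  {M : ℕ → Ω → Finset (Fin d)} {w : ℕ → Ω → Fin d → ℝ}

theorem IsRun.history_le (hrun : IsRun P ν 𝒮 oracle α n M w) {t : ℕ} (ht : t ≤ n + 1) :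
    history M w t ≤ mΩ := by
  refine iSup₂_le fun i hi => ?_
  have hi : i ∈ Finset.Icc 1 n := by simp at hi ⊢; omega
  exact sup_le (hrun.measurable_arm i hi).comap_le (hrun.measurable_reward i hi).comap_le

/-- Hoeffding's lemma for the weight of an item under `ν`, as a bound on a lower integral, which
needs no integrability in the products formed below. -/
theorem lintegral_exp_sub_integral_le_one [IsProbabilityMeasure ν]
    (hν : ∀ᵐ x ∂ν, ∀ e, x e ∈ Set.Icc (0 : ℝ) 1) (e : Fin d) (l : ℝ) :
    ∫⁻ x, ENNReal.ofReal (Real.exp (l * (x e - ∫ y, y e ∂ν) - l ^ 2 / 8)) ∂ν ≤ 1 := by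
  have h := hasSubgaussianMGF_of_mem_Icc (μ := ν) (X := fun x : Fin d → ℝ => x e)
    (a := 0) (b := 1) (measurable_pi_apply e).aemeasurable (hν.mono fun x hx => hx e)
  have h1 := h.mgf_le l
  have h2 := h.integrable_exp_mul l
  rw [← ofReal_integral_eq_lintegral_ofReal]
  · rw [← ENNReal.ofReal_one]
    apply ENNReal.ofReal_le_ofReal
    simp only [Real.exp_sub (l * _), integral_div]
    rw [div_le_one (Real.exp_pos _)]
    refine (show _ ≤ _ from h1).trans (Real.exp_le_exp.2 (le_of_eq ?_))
    simp
    ring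
  · simp only [Real.exp_sub (l * _)]
    exact h2.div_const _
  · exact Filter.Eventually.of_forall fun x => (Real.exp_pos _).le

/-- The exponential process `exp (l T_t(e) (ŵ_t(e) - μ(e)) - l² T_t(e) / 8)` has expectation at
most `1` from the end of the initialization on. It is a supermartingale: whether `e` is observed
in the next round is decided independently of the reward of that round. -/
theorem IsRun.lintegral_exp_le_one [IsProbabilityMeasure ν] [IsProbabilityMeasure P]
    (hν : ∀ᵐ x ∂ν, ∀ e, x e ∈ Set.Icc (0 : ℝ) 1)
    (hrun : IsRun P ν 𝒮 oracle α n M w) {e : Fin d}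
    (he : e ∈ initObserved oracle (initSteps 𝒮 oracle)) (l : ℝ) {t : ℕ}
    (hst : initSteps 𝒮 oracle ≤ t) (htn : t ≤ n) :
    ∫⁻ ω, ENNReal.ofReal (Real.exp (l * (runCount 𝒮 oracle M t e ω *
      (runMean 𝒮 oracle M w t e ω - ∫ y, y e ∂ν)) - l ^ 2 / 8 * runCount 𝒮 oracle M t e ω)) ∂P
      ≤ 1 := by
  have hV : Measurable fun x : Fin d → ℝ =>
      ENNReal.ofReal (Real.exp (l * (x e - ∫ y, y e ∂ν) - l ^ 2 / 8)) := by fun_prop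
  have hlaw : ∀ i ∈ Finset.Icc 1 n, ∫⁻ ω,
      ENNReal.ofReal (Real.exp (l * (w i ω e - ∫ y, y e ∂ν) - l ^ 2 / 8)) ∂P ≤ 1 := by
    intro i hi
    rw [← lintegral_map hV (hrun.measurable_reward i hi), hrun.law_reward i hi]
    exact lintegral_exp_sub_integral_le_one hν e l
  induction t, hst using Nat.le_induction with
  | base =>
    obtain ⟨τ, h1, h2, h3⟩ := exists_initObs_eq he
    refine le_trans (le_of_eq ?_) (hlaw τ (by simp; omega))
    congr 1 with ω
    simp only [runCount, runMean, mean_eq_of_lt (Nat.lt_succ_self _),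
      count_eq_one_of_lt (Nat.lt_succ_self _), h3]
    norm_num
  | succ t hst ih =>
    have ih := ih (by omega)
    have ht : t + 1 ∈ Finset.Icc 1 n := by simp; omega
    set Y : Ω → ENNReal := fun ω => ENNReal.ofReal (Real.exp (l * (runCount 𝒮 oracle M t e ω *
      (runMean 𝒮 oracle M w t e ω - ∫ y, y e ∂ν)) - l ^ 2 / 8 * runCount 𝒮 oracle M t e ω))
      with hY
    set V : Ω → ENNReal := fun ω =>
      ENNReal.ofReal (Real.exp (l * (w (t + 1) ω e - ∫ y, y e ∂ν) - l ^ 2 / 8)) with hVdef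
    have hGle : history M w (t + 1) ⊔ MeasurableSpace.comap (M (t + 1)) inferInstance ≤ mΩ :=
      sup_le (hrun.history_le (by omega)) (hrun.measurable_arm _ ht).comap_le
    have hMi : ∀ i ∈ Finset.Icc 1 t, Measurable[history M w (t + 1)] (M i) :=
      fun i hi => measurable_arm_history (t := t + 1) hi
    have hwi : ∀ i ∈ Finset.Icc 1 t, Measurable[history M w (t + 1)] (w i) :=
      fun i hi => measurable_reward_history (t := t + 1) hi
    have hYm : Measurable[history M w (t + 1)] Y := by
      have hc : Measurable[history M w (t + 1)] fun ω => (runCount 𝒮 oracle M t e ω : ℝ) :=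
        (measurable_of_countable _).comp (measurable_runCount hMi e)
      have hm : Measurable[history M w (t + 1)] (runMean 𝒮 oracle M w t e) :=
        measurable_runMean hMi hwi hst e
      exact ENNReal.measurable_ofReal.comp (Real.measurable_exp.comp
        (((hc.mul (hm.sub_const _)).const_mul l).sub (hc.const_mul _)))
    have hset : MeasurableSet[MeasurableSpace.comap (M (t + 1)) inferInstance]
        {ω | e ∈ M (t + 1) ω} := measurableSet_mem (comap_measurable (M (t + 1))) e
    have hY1 : Measurable[history M w (t + 1) ⊔ MeasurableSpace.comap (M (t + 1)) inferInstance]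
        ({ω | e ∈ M (t + 1) ω}.indicator Y) :=
      (hYm.mono le_sup_left le_rfl).indicator
        ((le_sup_right : _ ≤ history M w (t + 1) ⊔ _) _ hset)
    have hY0 : Measurable ({ω | e ∈ M (t + 1) ω}ᶜ.indicator Y) :=
      (hYm.mono (hrun.history_le (by omega)) le_rfl).indicator
        (measurableSet_mem (hrun.measurable_arm _ ht) e).compl
    have hVm : Measurable[MeasurableSpace.comap (w (t + 1)) inferInstance] V :=
      hV.comp (comap_measurable (w (t + 1)))
    have hsplit : ∀ ω, ENNReal.ofReal (Real.exp (l * (runCount 𝒮 oracle M (t + 1) e ω *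
        (runMean 𝒮 oracle M w (t + 1) e ω - ∫ y, y e ∂ν))
          - l ^ 2 / 8 * runCount 𝒮 oracle M (t + 1) e ω))
        = {ω | e ∈ M (t + 1) ω}ᶜ.indicator Y ω + V ω * {ω | e ∈ M (t + 1) ω}.indicator Y ω := by
      intro ω
      simp only [runCount, runMean]
      rw [count_mul_mean_sub_succ hst, count_succ hst]
      by_cases hω : e ∈ M (t + 1) ω
      · simp only [hω, if_true, Set.indicator, Set.mem_compl_iff, Set.mem_ofPred_eq, not_true,
          if_false, zero_add, hY, hVdef, runCount, runMean]
        rw [← ENNReal.ofReal_mul (Real.exp_pos _).le, ← Real.exp_add]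
        push_cast
        ring_nf
      · simp [hω, hY, Set.indicator, runCount, runMean]
    simp only [hsplit]
    rw [lintegral_add_left (hY0),
      lintegral_mul_eq_lintegral_mul_lintegral_of_independent_measurableSpace
        (hrun.measurable_reward _ ht).comap_le hGle (hrun.indep_reward _ ht) hVm hY1]
    refine le_trans (add_le_add_right (mul_le_of_le_one_left' (hlaw _ ht)) _) ?_
    rw [← lintegral_add_left (hY0)]
    refine le_trans (le_of_eq ?_) ih
    congr 1 with ω
    by_cases hω : e ∈ M (t + 1) ω <;> simp [Set.indicator, hω]

/-- A one-sided deviation (`σ = 1` or `σ = -1`) at a fixed number `k` of observations. -/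
theorem IsRun.measureReal_deviation_le_of_count_eq [IsProbabilityMeasure ν]
    [IsProbabilityMeasure P]
    (hν : ∀ᵐ x ∂ν, ∀ e, x e ∈ Set.Icc (0 : ℝ) 1)
    (hrun : IsRun P ν 𝒮 oracle α n M w) {e : Fin d}
    (he : e ∈ initObserved oracle (initSteps 𝒮 oracle)) {t : ℕ} (ht : 1 ≤ t)
    (hst : initSteps 𝒮 oracle ≤ t) (htn : t ≤ n) {k : ℕ} (hk : 1 ≤ k) {σ : ℝ} (hσ : σ ^ 2 = 1) :
    P.real {ω | runCount 𝒮 oracle M t e ω = k ∧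
      radius t k ≤ σ * (runMean 𝒮 oracle M w t e ω - ∫ y, y e ∂ν)} ≤ 1 / (t : ℝ) ^ 4 := by
  have ht0 : (0 : ℝ) < t := by exact_mod_cast ht
  have hk0 : (0 : ℝ) < k := by exact_mod_cast hk
  have hr2 : radius t k ^ 2 * k = 2 * Real.log t := by
    rw [radius, Real.sq_sqrt (by positivity)]
    field_simp
  have hr0 := radius_nonneg t k
  -- The exponent `l = 4 σ c` minimizes the bound `exp (- l σ c k + l² k / 8)`.
  have hE := hrun.lintegral_exp_le_one hν he (4 * σ * radius t k) hst htn
  have hm : Measurable fun ω => ENNReal.ofReal (Real.exp (4 * σ * radius t k *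
      (runCount 𝒮 oracle M t e ω * (runMean 𝒮 oracle M w t e ω - ∫ y, y e ∂ν))
        - (4 * σ * radius t k) ^ 2 / 8 * runCount 𝒮 oracle M t e ω)) := by
    have hMi : ∀ i ∈ Finset.Icc 1 t, Measurable (M i) := fun i hi =>
      hrun.measurable_arm i (Finset.Icc_subset_Icc_right htn hi)
    have hwi : ∀ i ∈ Finset.Icc 1 t, Measurable (w i) := fun i hi =>
      hrun.measurable_reward i (Finset.Icc_subset_Icc_right htn hi)
    have hc : Measurable fun ω => (runCount 𝒮 oracle M t e ω : ℝ) :=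
      (measurable_of_countable _).comp (measurable_runCount hMi e)
    have hm : Measurable (runMean 𝒮 oracle M w t e) := measurable_runMean hMi hwi hst e
    fun_prop
  have hmarkov := meas_ge_le_lintegral_div (μ := P) hm.aemeasurable
    (ε := ENNReal.ofReal ((t : ℝ) ^ 4)) (by simpa using by positivity) ENNReal.ofReal_ne_top
  refine ENNReal.toReal_le_of_le_ofReal (by positivity) ?_
  rw [ENNReal.ofReal_div_of_pos (by positivity), ENNReal.ofReal_one]
  refine le_trans (measure_mono ?_) (hmarkov.trans (ENNReal.div_le_div_right hE _))
  rintro ω ⟨h1, h2⟩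
  refine ENNReal.ofReal_le_ofReal ?_
  rw [← Real.exp_log (show (0 : ℝ) < (t : ℝ) ^ 4 by positivity), Real.exp_le_exp, Real.log_pow, h1]
  have h3 : radius t k * (radius t k * k)
      ≤ σ * (runMean 𝒮 oracle M w t e ω - ∫ y, y e ∂ν) * (radius t k * k) := by gcongr
  have h4 : (4 * σ * radius t k) ^ 2 / 8 * k = 2 * (radius t k ^ 2 * k) := by
    rw [mul_pow, mul_pow, hσ]; ring
  rw [h4, hr2]
  push_cast
  linarith

/-- Both sides and all the values `k ≤ t` of the counter, by a union bound. -/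
theorem IsRun.measureReal_deviation_le [IsProbabilityMeasure ν] [IsProbabilityMeasure P]
    (hν : ∀ᵐ x ∂ν, ∀ e, x e ∈ Set.Icc (0 : ℝ) 1)
    (hrun : IsRun P ν 𝒮 oracle α n M w) {e : Fin d}
    (he : e ∈ initObserved oracle (initSteps 𝒮 oracle)) {t : ℕ}
    (hs : 0 < initSteps 𝒮 oracle) (hst : initSteps 𝒮 oracle ≤ t) (htn : t ≤ n) :
    P.real {ω | radius t (runCount 𝒮 oracle M t e ω)
      < |runMean 𝒮 oracle M w t e ω - ∫ y, y e ∂ν|} ≤ 2 * (1 / (t : ℝ) ^ 2) := by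
  have ht : 1 ≤ t := by omega
  have ht1 : (1 : ℝ) ≤ t := by exact_mod_cast ht
  set D : ℝ → ℕ → Set Ω := fun σ k => {ω | runCount 𝒮 oracle M t e ω = k ∧
      radius t k ≤ σ * (runMean 𝒮 oracle M w t e ω - ∫ y, y e ∂ν)} with hD
  have hsub : {ω | radius t (runCount 𝒮 oracle M t e ω)
      < |runMean 𝒮 oracle M w t e ω - ∫ y, y e ∂ν|}
      ⊆ ⋃ k ∈ Finset.Icc 1 t, (D 1 k ∪ D (-1) k) := by
    intro ω hω
    have h1 : 1 ≤ runCount 𝒮 oracle M t e ω := one_le_runCount t e ω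
    have h2 : runCount 𝒮 oracle M t e ω + initSteps 𝒮 oracle ≤ t + 1 := count_add_le hst e
    simp only [Set.mem_iUnion, Finset.mem_Icc]
    refine ⟨runCount 𝒮 oracle M t e ω, ⟨h1, by omega⟩, ?_⟩
    rw [Set.mem_ofPred_eq, lt_abs] at hω
    rcases hω with h | h
    · exact Or.inl ⟨rfl, by linarith⟩
    · exact Or.inr ⟨rfl, by linarith⟩
  calc _ ≤ P.real (⋃ k ∈ Finset.Icc 1 t, (D 1 k ∪ D (-1) k)) :=
        measureReal_mono hsub (measure_ne_top _ _)
    _ ≤ ∑ k ∈ Finset.Icc 1 t, P.real (D 1 k ∪ D (-1) k) := measureReal_biUnion_finset_le _ _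
    _ ≤ ∑ k ∈ Finset.Icc 1 t, 2 * (1 / (t : ℝ) ^ 4) := by
        refine Finset.sum_le_sum fun k hk => (measureReal_union_le _ _).trans ?_
        have hk := (Finset.mem_Icc.1 hk).1
        have h1 := hrun.measureReal_deviation_le_of_count_eq hν he ht hst htn hk (σ := 1) (by simp)
        have h2 := hrun.measureReal_deviation_le_of_count_eq hν he ht hst htn hk (σ := -1)
          (by simp)
        linarith
    _ = 2 * (t / (t : ℝ) ^ 4) := by simp; ring
    _ ≤ 2 * (1 / (t : ℝ) ^ 2) := by
        refine mul_le_mul_of_nonneg_left ?_ zero_le_two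
        rw [div_le_div_iff₀ (by positivity) (by positivity)]
        have : (t : ℝ) ^ 3 ≤ (t : ℝ) ^ 4 := pow_le_pow_right₀ ht1 (by norm_num)
        nlinarith

end Concentration

/-! ### One round of the algorithm -/

section Round

variable {d m n : ℕ} {α : ℝ} {𝒮 : Finset (Finset (Fin d))}
  {oracle : (Fin d → ℝ) → Finset (Fin d)} {ν : Measure (Fin d → ℝ)}
  {Ω : Type*} {mΩ : MeasurableSpace Ω} {P : Measure Ω}
  {M : ℕ → Ω → Finset (Fin d)} {w : ℕ → Ω → Fin d → ℝ}

theorem integrable_comp_arm [IsFiniteMeasure P] {X : Ω → Finset (Fin d)} (hX : Measurable X)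
    (g : Finset (Fin d) → ℝ) : Integrable (fun ω => g (X ω)) P :=
  Integrable.comp_measurable (f := X) (g := g) .of_finite hX

theorem integrable_eval [IsProbabilityMeasure ν]
    (hν : ∀ᵐ x ∂ν, ∀ e, x e ∈ Set.Icc (0 : ℝ) 1) (e : Fin d) :
    Integrable (fun x : Fin d → ℝ => x e) ν := by
  refine Integrable.of_bound (measurable_pi_apply e).aestronglyMeasurable 1 (hν.mono fun x hx => ?_)
  rw [Real.norm_eq_abs, abs_le]
  exact ⟨by linarith [(hx e).1], (hx e).2⟩

theorem integral_eval_mem_Icc [IsProbabilityMeasure ν]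
    (hν : ∀ᵐ x ∂ν, ∀ e, x e ∈ Set.Icc (0 : ℝ) 1) (e : Fin d) :
    ∫ x, x e ∂ν ∈ Set.Icc (0 : ℝ) 1 := by
  refine ⟨integral_nonneg_of_ae (hν.mono fun x hx => (hx e).1), ?_⟩
  have := integral_mono_ae (integrable_eval hν e) (integrable_const (1 : ℝ))
    (hν.mono fun x hx => (hx e).2)
  simpa using this

/-- The gap of a super arm is at most the number of items of an optimal one. -/
theorem f_sub_f_le {S S' : Finset (Fin d)} (hS : S.card ≤ m) {x : Fin d → ℝ}
    (hx : ∀ e, x e ∈ Set.Icc (0 : ℝ) 1) : f S x - f S' x ≤ m := by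
  have h1 : f S x ≤ ∑ _e ∈ S, (1 : ℝ) := Finset.sum_le_sum fun e _ => (hx e).2
  have h2 : 0 ≤ f S' x := Finset.sum_nonneg fun e _ => (hx e).1
  have h3 : (S.card : ℝ) ≤ m := by exact_mod_cast hS
  simp at h1
  linarith

/-- A super arm that is chosen before the rewards of a round are drawn earns in expectation as much
as it would earn under the mean rewards. -/
theorem IsRun.integral_reward_eq [IsProbabilityMeasure ν] [IsProbabilityMeasure P]
    (hν : ∀ᵐ x ∂ν, ∀ e, x e ∈ Set.Icc (0 : ℝ) 1) (hrun : IsRun P ν 𝒮 oracle α n M w)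
    {t : ℕ} (ht : t ∈ Finset.Icc 1 n) {X : Ω → Finset (Fin d)}
    (hX : Measurable[history M w t ⊔ MeasurableSpace.comap (M t) inferInstance] X) :
    ∫ ω, f (X ω) (w t ω) ∂P = ∫ ω, f (X ω) (fun e => ∫ x, x e ∂ν) ∂P := by
  have hle : history M w t ⊔ MeasurableSpace.comap (M t) inferInstance ≤ mΩ :=
    sup_le (hrun.history_le (by simp at ht; omega)) (hrun.measurable_arm _ ht).comap_le
  have hXm : Measurable X := hX.mono hle le_rfl
  have hw := hrun.measurable_reward t ht
  have hint : ∀ e, Integrable (fun ω => w t ω e) P := fun e => by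
    have := integrable_eval hν e
    rw [← hrun.law_reward t ht] at this
    exact this.comp_measurable hw
  have hmean : ∀ e, ∫ ω, w t ω e ∂P = ∫ x, x e ∂ν := fun e => by
    rw [← hrun.law_reward t ht, integral_map hw.aemeasurable
      (measurable_pi_apply e).aestronglyMeasurable]
  have hindep : IndepFun (w t) X P := by
    rw [IndepFun_iff_Indep]
    exact indep_of_indep_of_le_right (hrun.indep_reward t ht) hX.comap_le
  have hf : ∀ (S : Finset (Fin d)) (x : Fin d → ℝ),
      f S x = ∑ e, (if e ∈ S then 1 else 0) * x e := fun S x => by simp [f]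
  have hi : ∀ e, Integrable (fun ω => if e ∈ X ω then (1 : ℝ) else 0) P := fun e =>
    integrable_comp_arm hXm fun S => if e ∈ S then 1 else 0
  have hind : ∀ e, IndepFun (fun ω => if e ∈ X ω then (1 : ℝ) else 0) (fun ω => w t ω e) P :=
    fun e => hindep.symm.comp (φ := fun S => if e ∈ S then (1 : ℝ) else 0) (ψ := fun x : Fin d → ℝ => x e)
      (measurable_of_countable _) (measurable_pi_apply e)
  have hprod : ∀ e, Integrable (fun ω => (if e ∈ X ω then (1 : ℝ) else 0) * w t ω e) P :=
    fun e => (hind e).integrable_mul (hi e) (hint e)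
  simp only [hf]
  rw [integral_finsetSum _ fun e _ => hprod e,
    integral_finsetSum _ fun e _ => (hi e).mul_const _]
  refine Finset.sum_congr rfl fun e _ => ?_
  rw [(hind e).integral_fun_mul_eq_mul_integral (hi e).1 (hint e).1, hmean, integral_mul_const]

theorem IsRun.regret_eq [IsProbabilityMeasure ν] [IsProbabilityMeasure P]
    (hν : ∀ᵐ x ∂ν, ∀ e, x e ∈ Set.Icc (0 : ℝ) 1) (hrun : IsRun P ν 𝒮 oracle α n M w)
    (Mstar : Finset (Fin d)) :
    regret P n Mstar M w = ∑ t ∈ Finset.Icc 1 n, ∫ ω,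
      (f Mstar (fun e => ∫ x, x e ∂ν) - f (M t ω) (fun e => ∫ x, x e ∂ν)) ∂P := by
  refine Finset.sum_congr rfl fun t ht => ?_
  rw [hrun.integral_reward_eq hν ht (X := fun _ => Mstar) measurable_const,
    hrun.integral_reward_eq hν ht (Measurable.mono (comap_measurable (M t)) le_sup_right le_rfl),
    integral_sub (integrable_const _)
      (integrable_comp_arm (hrun.measurable_arm t ht) fun S => f S fun e => ∫ x, x e ∂ν)]

theorem card_mul_exploreWeight_le (α : ℝ) (k t : ℕ) :
    k * exploreWeight α k t ≤ (t : ℝ) ^ (-α) / 2 := by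
  rcases Nat.eq_zero_or_pos k with rfl | hk
  · simp; positivity
  · refine le_of_eq ?_
    have : (0 : ℝ) < k := by exact_mod_cast hk
    rw [exploreWeight, Real.rpow_neg (by positivity), div_eq_mul_inv, mul_inv, mul_inv]
    field_simp

theorem exploreWeight_nonneg (α : ℝ) (k t : ℕ) : 0 ≤ exploreWeight α k t := by
  unfold exploreWeight; positivity

theorem card_mul_exploreWeight_le_one (hα₀ : 0 ≤ α) (k : ℕ) {t : ℕ} (ht : 1 ≤ t) :
    k * exploreWeight α k t ≤ 1 := by
  refine (card_mul_exploreWeight_le α k t).trans ?_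
  have : (t : ℝ) ^ (-α) ≤ 1 :=
    Real.rpow_le_one_of_one_le_of_nonpos (by exact_mod_cast ht) (by linarith)
  linarith

/-- Averaging a function of the super arm over the sampling distribution of a round. -/
theorem sum_policy_mul (h : IsOracle 𝒮 oracle) (t : ℕ) (g : Finset (Fin d) → ℝ) (ω : Ω) :
    ∑ S ∈ 𝒮, policy 𝒮 oracle α (fun i => w i ω) (fun i => M i ω) t S * g S
      = (1 - (initObserved oracle (initSteps 𝒮 oracle)).card *
          exploreWeight α (initObserved oracle (initSteps 𝒮 oracle)).card t)
          * g (greedyArm 𝒮 oracle M w t ω)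
        + ∑ e ∈ initObserved oracle (initSteps 𝒮 oracle),
          exploreWeight α (initObserved oracle (initSteps 𝒮 oracle)).card t
            * g (initArm oracle (initSteps 𝒮 oracle) e) := by
  simp only [policy, add_mul, Finset.sum_add_distrib, Finset.sum_mul]
  congr 1
  · rw [Finset.sum_eq_single_of_mem _ (h.mem _) fun S _ hS => by rw [if_neg hS]; ring, if_pos rfl,
      mul_one]
    rfl
  · rw [Finset.sum_comm]
    refine Finset.sum_congr rfl fun e he => ?_
    rw [Finset.sum_eq_single_of_mem _ (initArm_mem h he) fun S _ hS => by rw [if_neg hS]; ring,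
      if_pos rfl, mul_one]

/-- The conditional law of the super arm of a round, tested against a variable `g` of the past. -/
theorem IsRun.integral_indicator_mul_eq [IsProbabilityMeasure P]
    (hrun : IsRun P ν 𝒮 oracle α n M w) {t : ℕ} (ht : t ∈ Finset.Icc 1 n)
    (hst : initSteps 𝒮 oracle < t) {S : Finset (Fin d)} (hS : S ∈ 𝒮) {g : Ω → ℝ}
    (hg : Measurable[history M w t] g) {C : ℝ} (hC : ∀ ω, |g ω| ≤ C) :
    ∫ ω, (if M t ω = S then 1 else 0) * g ω ∂P
      = ∫ ω, policy 𝒮 oracle α (fun i => w i ω) (fun i => M i ω) t S * g ω ∂P := by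
  have hle : history M w t ≤ mΩ := hrun.history_le (by simp at ht; omega)
  have hset : MeasurableSet (M t ⁻¹' {S}) := hrun.measurable_arm t ht (.singleton S)
  have h1 : Integrable ((M t ⁻¹' {S}).indicator fun _ => (1 : ℝ)) P :=
    (integrable_const _).indicator hset
  have h2 : Integrable (((M t ⁻¹' {S}).indicator fun _ => (1 : ℝ)) * g) P :=
    h1.mul_bdd (c := C) (hg.mono hle le_rfl).aestronglyMeasurable (.of_forall hC)
  have h3 := condExp_mul_of_stronglyMeasurable_right hg.stronglyMeasurable h2 h1
  have h4 := hrun.main t ht hst S hS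
  calc _ = ∫ ω, (((M t ⁻¹' {S}).indicator fun _ => (1 : ℝ)) * g) ω ∂P := by
        congr 1 with ω
        by_cases hω : M t ω = S <;> simp [Set.indicator, hω]
    _ = ∫ ω, (P[((M t ⁻¹' {S}).indicator fun _ => (1 : ℝ)) * g | history M w t]) ω ∂P :=
        (integral_condExp hle).symm
    _ = _ := by
        refine integral_congr_ae ?_
        filter_upwards [h3, h4] with ω h5 h6
        rw [h5, Pi.mul_apply, h6]

theorem IsRun.integrable_policy_mul [IsProbabilityMeasure P] (h : IsOracle 𝒮 oracle)
    (hrun : IsRun P ν 𝒮 oracle α n M w) {t : ℕ} (ht : t ∈ Finset.Icc 1 n)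
    (hst : initSteps 𝒮 oracle < t) (S : Finset (Fin d)) {g : Ω → ℝ}
    (hg : Measurable g) {C : ℝ} (hC : ∀ ω, |g ω| ≤ C) :
    Integrable (fun ω => policy 𝒮 oracle α (fun i => w i ω) (fun i => M i ω) t S * g ω) P := by
  refine Integrable.mul_bdd (c := C) ?_ hg.aestronglyMeasurable (.of_forall hC)
  have htn := (Finset.mem_Icc.1 ht).2
  have hgr : Measurable (greedyArm 𝒮 oracle M w t) := measurable_greedyArm h
    (fun i hi => hrun.measurable_arm i (by simp at hi ⊢; omega))
    (fun i hi => hrun.measurable_reward i (by simp at hi ⊢; omega)) (by omega)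
  exact ((integrable_comp_arm hgr fun S' => if S = S' then (1 : ℝ) else 0).const_mul _).add
    (integrable_const _)

/-- Almost surely, the algorithm plays a super arm of the class. -/
theorem IsRun.ae_arm_mem [IsProbabilityMeasure P] (h : IsOracle 𝒮 oracle)
    (hrun : IsRun P ν 𝒮 oracle α n M w) {t : ℕ} (ht : t ∈ Finset.Icc 1 n) :
    ∀ᵐ ω ∂P, M t ω ∈ 𝒮 := by
  rcases le_or_gt t (initSteps 𝒮 oracle) with hst | hst
  · filter_upwards [hrun.init t ht hst] with ω hω
    rw [hω]
    exact h.mem _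
  have hM := hrun.measurable_arm t ht
  have hi : ∀ S, Integrable (fun ω => (if M t ω = S then (1 : ℝ) else 0) * 1) P := fun S =>
    integrable_comp_arm hM fun S' => (if S' = S then 1 else 0) * 1
  have h1 : ∫ ω, (1 - if M t ω ∈ 𝒮 then (1 : ℝ) else 0) ∂P = 0 := by
    have h2 : ∀ ω, (if M t ω ∈ 𝒮 then (1 : ℝ) else 0)
        = ∑ S ∈ 𝒮, (if M t ω = S then 1 else 0) * 1 := fun ω => by simp
    have hb : ∀ ω : Ω, |(1 : ℝ)| ≤ 1 := by simp
    simp only [h2]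
    rw [integral_sub (integrable_const _) (integrable_finsetSum _ fun S _ => hi S),
      integral_finsetSum _ fun S _ => hi S, Finset.sum_congr rfl fun S hS =>
        hrun.integral_indicator_mul_eq ht hst hS (g := fun _ => 1) measurable_const hb,
      ← integral_finsetSum _ fun S _ =>
        hrun.integrable_policy_mul h ht hst S (g := fun _ => 1) measurable_const hb]
    have h3 := sum_policy_mul (α := α) (M := M) (w := w) h t fun _ => 1
    simp only [h3]
    simp
  rw [integral_eq_zero_iff_of_nonneg (fun ω => by simp only [Pi.zero_apply]; split_ifs <;> simp)
    (integrable_comp_arm hM fun S' => 1 - if S' ∈ 𝒮 then (1 : ℝ) else 0)] at h1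
  filter_upwards [h1] with ω hω
  by_contra hn
  simp [hn] at hω

/-- Averaging over the super arm played in a round of the main loop amounts to averaging over the
sampling distribution. -/
theorem IsRun.integral_arm_eq [IsProbabilityMeasure P] (h : IsOracle 𝒮 oracle)
    (hrun : IsRun P ν 𝒮 oracle α n M w) {t : ℕ} (ht : t ∈ Finset.Icc 1 n)
    (hst : initSteps 𝒮 oracle < t) {g : Finset (Fin d) → Ω → ℝ}
    (hg : ∀ S, Measurable[history M w t] (g S)) {C : Finset (Fin d) → ℝ}
    (hC : ∀ S ω, |g S ω| ≤ C S) :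
    ∫ ω, g (M t ω) ω ∂P
      = ∫ ω, ((1 - (initObserved oracle (initSteps 𝒮 oracle)).card *
          exploreWeight α (initObserved oracle (initSteps 𝒮 oracle)).card t)
          * g (greedyArm 𝒮 oracle M w t ω) ω
        + ∑ e ∈ initObserved oracle (initSteps 𝒮 oracle),
          exploreWeight α (initObserved oracle (initSteps 𝒮 oracle)).card t
            * g (initArm oracle (initSteps 𝒮 oracle) e) ω) ∂P := by
  have hle : history M w t ≤ mΩ := hrun.history_le (by simp at ht; omega)
  have hM := hrun.measurable_arm t ht
  have hi : ∀ S, Integrable (fun ω => (if M t ω = S then (1 : ℝ) else 0) * g S ω) P := fun S =>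
    (integrable_comp_arm hM fun S' => if S' = S then (1 : ℝ) else 0).mul_bdd (c := C S)
      ((hg S).mono hle le_rfl).aestronglyMeasurable (.of_forall (hC S))
  calc _ = ∫ ω, ∑ S ∈ 𝒮, (if M t ω = S then 1 else 0) * g S ω ∂P := by
        refine integral_congr_ae ?_
        filter_upwards [hrun.ae_arm_mem h ht] with ω hω
        simp [hω]
    _ = ∑ S ∈ 𝒮, ∫ ω, policy 𝒮 oracle α (fun i => w i ω) (fun i => M i ω) t S * g S ω ∂P := by
        rw [integral_finsetSum _ fun S _ => hi S]
        exact Finset.sum_congr rfl fun S hS =>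
          hrun.integral_indicator_mul_eq ht hst hS (hg S) (hC S)
    _ = _ := by
        rw [← integral_finsetSum _ fun S _ =>
          hrun.integrable_policy_mul h ht hst S ((hg S).mono hle le_rfl) (hC S)]
        exact integral_congr_ae (.of_forall fun ω => sum_policy_mul h t (fun S => g S ω) ω)

theorem abs_width_le {t : ℕ} (S : Finset (Fin d)) (ω : Ω) :
    |width 𝒮 oracle M t S ω| ≤ ∑ _e ∈ S, √(2 * Real.log (t - 1 : ℕ)) := by
  rw [abs_of_nonneg (width_nonneg _ _ _)]
  exact width_le _ _ _

theorem IsRun.integrable_width [IsProbabilityMeasure P] (hrun : IsRun P ν 𝒮 oracle α n M w)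
    {t : ℕ} (ht : t ∈ Finset.Icc 1 n) {X : Ω → Finset (Fin d)} (hX : Measurable X) :
    Integrable (fun ω => width 𝒮 oracle M t (X ω) ω) P := by
  have hMi : ∀ i ∈ Finset.Icc 1 (t - 1), Measurable (M i) := fun i hi =>
    hrun.measurable_arm i (by simp at hi ht ⊢; omega)
  have hXe : (fun ω => width 𝒮 oracle M t (X ω) ω)
      = fun ω => ∑ S, (if X ω = S then 1 else 0) * width 𝒮 oracle M t S ω := by
    ext ω; simp
  rw [hXe]
  exact integrable_finsetSum _ fun S _ =>
    (integrable_comp_arm hX fun S' => if S' = S then (1 : ℝ) else 0).mul_bdd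
      (measurable_width hMi S).aestronglyMeasurable (.of_forall (abs_width_le S))

/-- Optimism: as long as the confidence intervals hold, the gap of the optimistic super arm is at
most twice its width. -/
theorem gap_greedyArm_le (h : IsOracle 𝒮 oracle) {Mstar : Finset (Fin d)} (hMstar : Mstar ∈ 𝒮)
    {x : Fin d → ℝ} {t : ℕ} {ω : Ω}
    (hω : ∀ S ∈ 𝒮, ∀ e ∈ S, |runMean 𝒮 oracle M w (t - 1) e ω - x e|
      ≤ radius (t - 1) (runCount 𝒮 oracle M (t - 1) e ω)) :
    f Mstar x - f (greedyArm 𝒮 oracle M w t ω) x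
      ≤ 2 * width 𝒮 oracle M t (greedyArm 𝒮 oracle M w t ω) ω := by
  set U := ucb (initSteps 𝒮 oracle + 1) (initObs oracle (fun i => w i ω) (initSteps 𝒮 oracle))
    (fun i => w i ω) (fun i => M i ω) t with hU
  have hUe : ∀ e, U e = runMean 𝒮 oracle M w (t - 1) e ω
      + radius (t - 1) (runCount 𝒮 oracle M (t - 1) e ω) := fun e => rfl
  have h1 : f Mstar x ≤ f Mstar U := Finset.sum_le_sum fun e he => by
    have := (abs_le.1 (hω _ hMstar e he)).1
    rw [hUe]
    linarith
  have h2 : f Mstar U ≤ f (greedyArm 𝒮 oracle M w t ω) U := h.le U _ hMstar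
  have h3 : f (greedyArm 𝒮 oracle M w t ω) U ≤ f (greedyArm 𝒮 oracle M w t ω) x
      + 2 * width 𝒮 oracle M t (greedyArm 𝒮 oracle M w t ω) ω := by
    rw [f, f, width, Finset.mul_sum, ← Finset.sum_add_distrib]
    refine Finset.sum_le_sum fun e he => ?_
    have := (abs_le.1 (hω _ (h.mem U) e he)).2
    rw [hUe]
    linarith
  linarith

/-- The probability that some confidence interval of an item of a super arm fails in round `t`. The
bound also holds for `t = 1`, where it is `0`: the main loop starts in the first round only if all
super arms are empty. -/
theorem IsRun.measureReal_bad_le [IsProbabilityMeasure ν] [IsProbabilityMeasure P]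
    (hν : ∀ᵐ x ∂ν, ∀ e, x e ∈ Set.Icc (0 : ℝ) 1) (h : IsOracle 𝒮 oracle)
    (hrun : IsRun P ν 𝒮 oracle α n M w) {t : ℕ} (ht : t ∈ Finset.Icc 1 n)
    (hst : initSteps 𝒮 oracle < t) :
    P.real {ω | ∃ S ∈ 𝒮, ∃ e ∈ S, radius (t - 1) (runCount 𝒮 oracle M (t - 1) e ω)
      < |runMean 𝒮 oracle M w (t - 1) e ω - ∫ x, x e ∂ν|}
      ≤ d * (2 * (1 / ((t - 1 : ℕ) : ℝ) ^ 2)) := by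
  classical
  have hsub : {ω | ∃ S ∈ 𝒮, ∃ e ∈ S, radius (t - 1) (runCount 𝒮 oracle M (t - 1) e ω)
      < |runMean 𝒮 oracle M w (t - 1) e ω - ∫ x, x e ∂ν|}
      ⊆ ⋃ e ∈ 𝒮.biUnion id, {ω | radius (t - 1) (runCount 𝒮 oracle M (t - 1) e ω)
        < |runMean 𝒮 oracle M w (t - 1) e ω - ∫ x, x e ∂ν|} := by
    rintro ω ⟨S, hS, e, he, hω⟩
    simp only [Set.mem_iUnion]
    exact ⟨e, Finset.mem_biUnion.2 ⟨S, hS, he⟩, hω⟩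
  refine (measureReal_mono hsub (measure_ne_top _ _)).trans
    ((measureReal_biUnion_finset_le _ _).trans ?_)
  have hsum : ∀ e ∈ 𝒮.biUnion id, P.real {ω | radius (t - 1) (runCount 𝒮 oracle M (t - 1) e ω)
        < |runMean 𝒮 oracle M w (t - 1) e ω - ∫ x, x e ∂ν|}
      ≤ 2 * (1 / ((t - 1 : ℕ) : ℝ) ^ 2) := by
    intro e he
    obtain ⟨S, hS, he⟩ := Finset.mem_biUnion.1 he
    exact hrun.measureReal_deviation_le hν
      (mem_initObserved_of_initWeight_eq_zero (initWeight_eq_zero_of_mem_initSteps h hS he))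
      (initSteps_pos h hS he) (by omega) (by simp at ht; omega)
  refine (Finset.sum_le_card_nsmul _ _ _ hsum).trans ?_
  rw [nsmul_eq_mul]
  gcongr
  simpa using Finset.card_le_univ (𝒮.biUnion id)

/-- The expected gap of the super arm of a round of the main loop. The three terms come from the
failure of a confidence interval, from the exploration, and from the width of the super arm. The
width is that of the super arm that is played, not of the optimistic one: the latter is played with
probability `1 - m₀ α_t`, the very weight with which its gap enters the expectation. -/
theorem IsRun.integral_gap_le [IsProbabilityMeasure ν] [IsProbabilityMeasure P]
    (hα₀ : 0 ≤ α) (hcard : ∀ S ∈ 𝒮, S.card ≤ m)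
    (hν : ∀ᵐ x ∂ν, ∀ e, x e ∈ Set.Icc (0 : ℝ) 1) (h : IsOracle 𝒮 oracle)
    {Mstar : Finset (Fin d)} (hMstar : Mstar ∈ 𝒮)
    (hrun : IsRun P ν 𝒮 oracle α n M w) {t : ℕ} (ht : t ∈ Finset.Icc 1 n)
    (hst : initSteps 𝒮 oracle < t) :
    ∫ ω, (f Mstar (fun e => ∫ x, x e ∂ν) - f (M t ω) (fun e => ∫ x, x e ∂ν)) ∂P
      ≤ m * (d * (2 * (1 / ((t - 1 : ℕ) : ℝ) ^ 2))) + m * ((t : ℝ) ^ (-α) / 2)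
        + 2 * ∫ ω, width 𝒮 oracle M t (M t ω) ω ∂P := by
  have ht' := Finset.mem_Icc.1 ht
  set μ : Fin d → ℝ := fun e => ∫ x, x e ∂ν with hμ
  have hμ01 : ∀ e, μ e ∈ Set.Icc (0 : ℝ) 1 := integral_eval_mem_Icc hν
  have hgap : ∀ S, f Mstar μ - f S μ ≤ m := fun S => f_sub_f_le (hcard _ hMstar) hμ01
  set E := initObserved oracle (initSteps 𝒮 oracle) with hE
  set a := exploreWeight α E.card t with ha
  set p := 1 - E.card * a with hp
  set B := {ω | ∃ S ∈ 𝒮, ∃ e ∈ S, radius (t - 1) (runCount 𝒮 oracle M (t - 1) e ω)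
      < |runMean 𝒮 oracle M w (t - 1) e ω - μ e|} with hB
  have ha0 : 0 ≤ a := exploreWeight_nonneg _ _ _
  have hp0 : 0 ≤ p := sub_nonneg.2 (card_mul_exploreWeight_le_one hα₀ _ ht'.1)
  have hp1 : p ≤ 1 := sub_le_self _ (by positivity)
  have hMi : ∀ i ∈ Finset.Icc 1 (t - 1), Measurable (M i) := fun i hi =>
    hrun.measurable_arm i (by simp at hi ⊢; omega)
  have hwi : ∀ i ∈ Finset.Icc 1 (t - 1), Measurable (w i) := fun i hi =>
    hrun.measurable_reward i (by simp at hi ⊢; omega)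
  have hgr : Measurable (greedyArm 𝒮 oracle M w t) := measurable_greedyArm h hMi hwi (by omega)
  have hBm : MeasurableSet B := by
    have hBe : B = ⋃ S ∈ 𝒮, ⋃ e ∈ S, {ω | radius (t - 1) (runCount 𝒮 oracle M (t - 1) e ω)
        < |runMean 𝒮 oracle M w (t - 1) e ω - μ e|} := by
      ext ω; simp [hB]
    rw [hBe]
    refine Finset.measurableSet_biUnion _ fun S _ => Finset.measurableSet_biUnion _ fun e _ => ?_
    exact measurableSet_lt
      ((measurable_of_countable (radius (t - 1))).comp (measurable_runCount hMi e))
      (((measurable_runMean hMi hwi (by omega) e).sub_const _).abs)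
  have hwm : ∀ S, Measurable[history M w t] (width 𝒮 oracle M t S) := fun S =>
    measurable_width (fun i hi => measurable_arm_history hi) S
  have hwi' : ∀ {X : Ω → Finset (Fin d)}, Measurable X →
      Integrable (fun ω => width 𝒮 oracle M t (X ω) ω) P := hrun.integrable_width ht
  have hBi : Integrable (B.indicator fun _ => (m : ℝ)) P := (integrable_const _).indicator hBm
  have hgap_int : ∀ {X : Ω → Finset (Fin d)}, Measurable X →
      Integrable (fun ω => f Mstar μ - f (X ω) μ) P := fun hX =>
    integrable_comp_arm hX fun S => f Mstar μ - f S μ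
  -- Expected gap in terms of the optimistic super arm.
  have h1 : ∫ ω, (f Mstar μ - f (M t ω) μ) ∂P
      ≤ p * ∫ ω, (f Mstar μ - f (greedyArm 𝒮 oracle M w t ω) μ) ∂P + m * ((t : ℝ) ^ (-α) / 2) := by
    rw [hrun.integral_arm_eq h ht hst (g := fun S _ => f Mstar μ - f S μ)
      (fun S => measurable_const) (C := fun S => |f Mstar μ - f S μ|) fun S ω => le_rfl,
      integral_add ((hgap_int hgr).const_mul _) (integrable_const _), integral_const_mul,
      integral_const]
    simp only [probReal_univ, one_smul]
    gcongr
    calc _ ≤ ∑ _e ∈ E, a * m := Finset.sum_le_sum fun e _ => by gcongr; exact hgap _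
      _ = m * (E.card * a) := by simp; ring
      _ ≤ _ := by gcongr; exact card_mul_exploreWeight_le _ _ _
  -- The gap of the optimistic super arm.
  have h2 : ∫ ω, (f Mstar μ - f (greedyArm 𝒮 oracle M w t ω) μ) ∂P
      ≤ m * P.real B + 2 * ∫ ω, width 𝒮 oracle M t (greedyArm 𝒮 oracle M w t ω) ω ∂P := by
    have h3 : ∫ ω, B.indicator (fun _ => (m : ℝ)) ω ∂P = m * P.real B := by
      rw [integral_indicator_const _ hBm, smul_eq_mul, mul_comm]
    rw [← h3, ← integral_const_mul, ← integral_add hBi ((hwi' hgr).const_mul 2)]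
    refine integral_mono (hgap_int hgr) (hBi.add ((hwi' hgr).const_mul 2)) fun ω => ?_
    by_cases hω : ω ∈ B
    · have hw0 : 0 ≤ width 𝒮 oracle M t (greedyArm 𝒮 oracle M w t ω) ω := width_nonneg _ _ _
      simp only [hω, Set.indicator_of_mem]
      linarith [hgap (greedyArm 𝒮 oracle M w t ω)]
    · simp only [hω, not_false_eq_true, Set.indicator_of_notMem, zero_add]
      refine gap_greedyArm_le h hMstar fun S hS e he => ?_
      by_contra hn
      exact hω ⟨S, hS, e, he, not_le.1 hn⟩
  -- The width of the optimistic super arm is dominated by that of the super arm that is played.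
  have h3 : p * ∫ ω, width 𝒮 oracle M t (greedyArm 𝒮 oracle M w t ω) ω ∂P
      ≤ ∫ ω, width 𝒮 oracle M t (M t ω) ω ∂P := by
    rw [hrun.integral_arm_eq h ht hst hwm abs_width_le, ← integral_const_mul]
    refine integral_mono ((hwi' hgr).const_mul _) (((hwi' hgr).const_mul _).add
      (integrable_finsetSum _ fun e _ => (hwi' measurable_const).const_mul _)) fun ω => ?_
    exact le_add_of_nonneg_right
      (Finset.sum_nonneg fun e _ => mul_nonneg ha0 (width_nonneg _ _ _))
  have h4 : P.real B ≤ d * (2 * (1 / ((t - 1 : ℕ) : ℝ) ^ 2)) :=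
    hrun.measureReal_bad_le hν h ht hst
  have h5 : p * (m * P.real B) ≤ m * (d * (2 * (1 / ((t - 1 : ℕ) : ℝ) ^ 2))) :=
    (mul_le_of_le_one_left (by positivity) hp1).trans (by gcongr)
  have h6 := mul_le_mul_of_nonneg_left h2 hp0
  linarith

/-- Summed over the main loop, the widths of the super arms that are played have expectation of
order `√(m d n log n)`. -/
theorem IsRun.sum_integral_width_le [IsProbabilityMeasure P]
    (hcard : ∀ S ∈ 𝒮, S.card ≤ m) (h : IsOracle 𝒮 oracle)
    (hrun : IsRun P ν 𝒮 oracle α n M w) :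
    ∑ t ∈ Finset.Ioc (initSteps 𝒮 oracle) n, ∫ ω, width 𝒮 oracle M t (M t ω) ω ∂P
      ≤ 2 * √2 * √(m * d * n * Real.log n) := by
  rcases le_or_gt (initSteps 𝒮 oracle) n with hsn | hsn
  swap
  · rw [Finset.Ioc_eq_empty (by omega), Finset.sum_empty]
    positivity
  have hint : ∀ t ∈ Finset.Ioc (initSteps 𝒮 oracle) n,
      Integrable (fun ω => width 𝒮 oracle M t (M t ω) ω) P := fun t ht =>
    have ht' : t ∈ Finset.Icc 1 n := by simp at ht ⊢; omega
    hrun.integrable_width ht' (hrun.measurable_arm t ht')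
  rw [← integral_finsetSum _ hint]
  have hae : ∀ᵐ ω ∂P, ∀ t ∈ Finset.Icc 1 n, M t ω ∈ 𝒮 :=
    (Finset.eventually_all _).2 fun t ht => hrun.ae_arm_mem h ht
  have := integral_mono_ae (integrable_finsetSum _ hint)
    (integrable_const (2 * √2 * √(m * d * n * Real.log n))) (hae.mono fun ω hω =>
      sum_radius_le (A := fun i => M i ω) hsn fun t ht => hcard _ (hω t (by simp at ht ⊢; omega)))
  simpa using this

/-! ### The regret bound -/

/-- The regret bound against a super arm of the class, which may be any comparator: optimism bounds
the gap of the optimistic super arm to every super arm of the class. -/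
theorem IsRun.regret_le [IsProbabilityMeasure ν] [IsProbabilityMeasure P]
    (hα₀ : 0 ≤ α) (hα₁ : α < 1) (hcard : ∀ S ∈ 𝒮, S.card ≤ m)
    (hν : ∀ᵐ x ∂ν, ∀ e, x e ∈ Set.Icc (0 : ℝ) 1) (horacle : IsOracle 𝒮 oracle)
    {Mstar : Finset (Fin d)} (hMstar : Mstar ∈ 𝒮) (hrun : IsRun P ν 𝒮 oracle α n M w) :
    regret P n Mstar M w ≤
      54 * √(m * d * n * Real.log n) + 5 * m * d
        + m * (n : ℝ) ^ (1 - α) / (2 * (1 - α)) := by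
  set s := initSteps 𝒮 oracle with hs
  set W : ℕ → ℝ := fun t => ∫ ω, width 𝒮 oracle M t (M t ω) ω ∂P with hW
  have hround : ∀ t ∈ Finset.Icc 1 n,
      ∫ ω, (f Mstar (fun e => ∫ x, x e ∂ν) - f (M t ω) (fun e => ∫ x, x e ∂ν)) ∂P
        ≤ (if t ≤ s then (m : ℝ) else 0) + (m * d * 2 * (1 / ((t - 1 : ℕ) : ℝ) ^ 2)
          + m / 2 * (t : ℝ) ^ (-α)) + 2 * (if s < t then W t else 0) := by
    intro t ht
    rcases le_or_gt t s with hst | hst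
    · rw [if_pos hst, if_neg hst.not_gt]
      have h1 : ∫ ω, (f Mstar (fun e => ∫ x, x e ∂ν) - f (M t ω) (fun e => ∫ x, x e ∂ν)) ∂P
          ≤ ∫ _ω, (m : ℝ) ∂P :=
        integral_mono (integrable_comp_arm (hrun.measurable_arm t ht) fun S =>
          f Mstar (fun e => ∫ x, x e ∂ν) - f S (fun e => ∫ x, x e ∂ν)) (integrable_const _)
          fun ω => f_sub_f_le (hcard _ hMstar) (integral_eval_mem_Icc hν)
      simp only [integral_const, probReal_univ, one_smul] at h1
      have h2 : 0 ≤ m * d * 2 * (1 / ((t - 1 : ℕ) : ℝ) ^ 2) + m / 2 * (t : ℝ) ^ (-α) := by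
        positivity
      linarith
    · rw [if_neg hst.not_ge, if_pos hst]
      have := hrun.integral_gap_le hα₀ hcard hν horacle hMstar ht hst
      linarith
  have h1 : ∑ t ∈ Finset.Icc 1 n, (if t ≤ s then (m : ℝ) else 0) ≤ m * d := by
    rw [← Finset.sum_filter, Finset.sum_const, nsmul_eq_mul, mul_comm]
    have hsub : (Finset.Icc 1 n).filter (· ≤ s) ⊆ Finset.Icc 1 s := fun t ht => by
      simp at ht ⊢; omega
    have h2 := (Finset.card_le_card hsub).trans (by simpa using initSteps_le horacle)
    gcongr
  have h2 : ∑ t ∈ Finset.Icc 1 n, (if s < t then W t else 0)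
      ≤ 2 * √2 * √(m * d * n * Real.log n) := by
    rw [← Finset.sum_filter]
    have hIoc : (Finset.Icc 1 n).filter (s < ·) = Finset.Ioc s n := by
      ext t; simp; omega
    rw [hIoc]
    exact hrun.sum_integral_width_le hcard horacle
  have h3 := mul_le_mul_of_nonneg_left (sum_inv_sq_le_two n)
    (show (0 : ℝ) ≤ m * d * 2 by positivity)
  have h4 := mul_le_mul_of_nonneg_left (sum_rpow_neg_le hα₀ hα₁ n)
    (show (0 : ℝ) ≤ m / 2 by positivity)
  have h5 : (m : ℝ) / 2 * ((n : ℝ) ^ (1 - α) / (1 - α))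
      = m * (n : ℝ) ^ (1 - α) / (2 * (1 - α)) := by
    rw [div_mul_div_comm]
  have h6 : √2 ≤ 2 := Real.sqrt_le_iff.2 ⟨by norm_num, by norm_num⟩
  have h7 := mul_le_mul_of_nonneg_right h6 (Real.sqrt_nonneg (m * d * n * Real.log n))
  have h8 := Real.sqrt_nonneg (m * d * n * Real.log n)
  rw [hrun.regret_eq hν]
  refine (Finset.sum_le_sum hround).trans ?_
  simp only [Finset.sum_add_distrib, ← Finset.mul_sum]
  linarith

end Round

end MixCombUCB

end

theorem mainTheorem10 {d m n : ℕ} {α : ℝ} (hα₀ : 0 ≤ α) (hα₁ : α < 1)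
    (𝒮 : Finset (Finset (Fin d))) (hcard : ∀ S ∈ 𝒮, S.card ≤ m)
    (oracle : (Fin d → ℝ) → Finset (Fin d)) (horacle : MixCombUCB.IsOracle 𝒮 oracle)
    (ν : Measure (Fin d → ℝ)) [IsProbabilityMeasure ν]
    (hν : ∀ᵐ x ∂ν, ∀ e, x e ∈ Set.Icc (0 : ℝ) 1)
    (Mstar : Finset (Fin d)) (hMstar : Mstar ∈ 𝒮)
    (hMstar_max : ∀ S ∈ 𝒮,
      MixCombUCB.f S (fun e => ∫ x, x e ∂ν) ≤ MixCombUCB.f Mstar (fun e => ∫ x, x e ∂ν))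
    {Ω : Type*} [MeasurableSpace Ω] (P : Measure Ω) [IsProbabilityMeasure P]
    (M : ℕ → Ω → Finset (Fin d)) (w : ℕ → Ω → Fin d → ℝ)
    (hrun : MixCombUCB.IsRun P ν 𝒮 oracle α n M w) :
    MixCombUCB.regret P n Mstar M w ≤
      54 * Real.sqrt (m * d * n * Real.log n) + 5 * m * d
        + m * (n : ℝ) ^ (1 - α) / (2 * (1 - α)) :=
  hrun.regret_le hα₀ hα₁ hcard hν horacle hMstar
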